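/- Let $s>0$ be real and let $\delta\in[0,1/2]$. For $n\in\mathbb N$ let $X^n$ be uniformly distributed on $\{0,1\}^n$, and let $Y^n$ be the output of the memoryless binary symmetric channel with crossover probability $\delta$ when its input is $X^n$ (each coordinate of $X^n$ is flipped independently with probability $\delta$). For a random variable $X$ on a finite alphabet let $G_s(X)=\mathbb E[\mathrm{ord}_X(X)^s]$, where $\mathrm{ord}_X(x)\in\{1,2,\dots\}$ is the position of $x$ when the alphabet is sorted by decreasing probability (ties broken arbitrarily). For a jointly distributed random variable $B$ with a finite alphabet let $G_s(X\mid B)=\mathbb E[\mathrm{ord}_{X\mid B}(X\mid B)^s]$, where $\mathrm{ord}_{X\mid B}(x\mid b)$ is the position of $x$ when the alphabet of $X$ is sorted by decreasing conditional probability given $B=b$. Define the guessing efficiency $$\gamma_s(\delta)=\limsup_{n\to\infty}\ \min_{f:\{0,1\}^n\to\{0,1\}}\frac{G_s(X^n\mid f(Y^n))}{G_s(X^n)} .$$ Then $$\gamma_s(\delta)\ \ge\ \max_{0\le\lambda\le1}\left[\,1-\frac{(s+1)\,(1-2\delta)^{\lambda}}{\bigl[(1+(1-2\delta)^{2(1-\lambda)})\,s+1\bigr]^{1/(1+(1-2\delta)^{2(1-\lambda)})}}\right],$$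 where the maximum is attained, and $0^0=1$ (relevant only for $\delta=1/2$). -/

import Mathlib

open Filter

noncomputable section

/-- The index (starting from `1`) of the symbol `x` in the order obtained by sorting the finite
alphabet `α` by decreasing value of the mass function `p`. Ties are broken by a fixed enumeration
of `α`; the guessing moments below do not depend on this choice. -/
def guessOrd {α : Type*} [Fintype α] (p : α → ℝ) (x : α) : ℕ :=
  (((Tuple.sort fun i => -p ((Fintype.equivFin α).symm i)).symm (Fintype.equivFin α x) :
    Fin (Fintype.card α)) : ℕ) + 1

/-- A strictly more probable symbol is guessed strictly earlier. -/
theorem guessOrd_lt_guessOrd {α : Type*} [Fintype α] (p : α → ℝ) {x x' : α} (h : p x' < p x) :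
    guessOrd p x < guessOrd p x' := by
  have hm := Tuple.monotone_sort fun i => -p ((Fintype.equivFin α).symm i)
  unfold guessOrd
  by_contra hc
  have hle := hm (Fin.le_def.mpr (Nat.le_of_succ_le_succ (not_lt.mp hc)))
  simp at hle
  linarith

/-- The minimal `s`-th order guessing-time moment `G_s(X)` of a random variable `X` with
probability mass function `p`. -/
def guessingMoment {α : Type*} [Fintype α] (s : ℝ) (p : α → ℝ) : ℝ :=
  ∑ x, p x * (guessOrd p x : ℝ) ^ s

/-- The minimal conditional guessing moment `G_s(X ∣ B)` of `X` given `B`, where `p x b` is the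
joint probability mass function of `(X, B)`: given `B = b`, the symbols are guessed by decreasing
conditional probability `P(X = x ∣ B = b)`. (Values `b` of probability zero contribute zero.) -/
def condGuessingMoment {α β : Type*} [Fintype α] [Fintype β] (s : ℝ) (p : α → β → ℝ) : ℝ :=
  ∑ b, ∑ x, p x b * (guessOrd (fun x' => p x' b / ∑ x'', p x'' b) x : ℝ) ^ s

/-- The law of an i.i.d. binary vector `X^n` whose entries have mass function `PX`. -/
def iidLaw (PX : Bool → ℝ) {n : ℕ} (x : Fin n → Bool) : ℝ :=
  ∏ i, PX (x i)

/-- The transition probability `P(Y^n = y ∣ X^n = x)` of the memoryless channel with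
single-letter transition probabilities `W`. -/
def memorylessChannel (W : Bool → Bool → ℝ) {n : ℕ} (x y : Fin n → Bool) : ℝ :=
  ∏ i, W (x i) (y i)

/-- The joint law `P(X^n = x, f(Y^n) = b)` of the input vector and the helper's bit. -/
def jointLaw (PX : Bool → ℝ) (W : Bool → Bool → ℝ) {n : ℕ} (f : (Fin n → Bool) → Bool)
    (x : Fin n → Bool) (b : Bool) : ℝ :=
  ∑ y with f y = b, iidLaw PX x * memorylessChannel W x y

/-- The guessing efficiency at blocklength `n`: the minimum of `G_s(X^n ∣ f(Y^n)) / G_s(X^n)`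
over all Boolean functions `f`. -/
def guessingEfficiencyAt (s : ℝ) (PX : Bool → ℝ) (W : Bool → Bool → ℝ) (n : ℕ) : ℝ :=
  (Finset.univ : Finset ((Fin n → Bool) → Bool)).inf' Finset.univ_nonempty fun f =>
    condGuessingMoment s (jointLaw PX W f) / guessingMoment s (iidLaw PX (n := n))

/-- The guessing efficiency `γ_s(P_X, P_{Y∣X})`: the limit superior, as the blocklength tends to
infinity, of the guessing efficiency at blocklength `n`. The limit superior is taken in the
extended reals, where it needs no boundedness assumption. -/
def guessingEfficiency (s : ℝ) (PX : Bool → ℝ) (W : Bool → Bool → ℝ) : EReal :=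
  limsup (fun n : ℕ => ((guessingEfficiencyAt s PX W n : ℝ) : EReal)) atTop

/-- The uniform mass function on the binary alphabet. -/
def uniformBit : Bool → ℝ := fun _ => 1 / 2

/-- The binary symmetric channel with crossover probability `δ`. -/
def bsc (δ : ℝ) : Bool → Bool → ℝ := fun x y => if x = y then 1 - δ else δ

end

/-! Put `ρ = 1 - 2δ` and let `φ` be the sign function of `f`. The joint law of `X^n` and the bit is
`2^{-n}(1 ± T_ρ φ)/2`. With `a_b` the `s`-th power of the guessing order given `b`, the conditional
moment is therefore the unconditional one minus `E[A · T_ρ φ]/2`, where `A = a_false - a_true`. Both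
orders are bijections, so `E A = 0`. Factor `ρ = τσ` with `τ = ρ^λ`, `σ = ρ^{1-λ}`. Self-adjointness
and Cauchy–Schwarz bound the correlation by `‖T_{τσ} A‖₂`; mean zero gains a factor `τ`
(`cubeMean_noiseOp_mul_sq_le`), and hypercontractivity (`cubeMean_noiseOp_sq_le`) leaves `τ‖A‖_p`,
`p = 1 + σ²`. The triangle inequality reduces `‖A‖_p` to power sums, whose asymptotics give the
constant. -/

/-! ### Noise on the cube, one coordinate at a time. -/

/-- The average of a function on the discrete cube. -/
noncomputable def cubeMean {n : ℕ} (A : (Fin n → Bool) → ℝ) : ℝ :=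
  (1 / 2) ^ n * ∑ x, A x

/-- The noise operator on the discrete cube with correlation parameter `ρ`. -/
noncomputable def noiseOp (ρ : ℝ) {n : ℕ} (A : (Fin n → Bool) → ℝ) (x : Fin n → Bool) : ℝ :=
  ∑ y, memorylessChannel (bsc ((1 - ρ) / 2)) x y * A y

/-- The part of `A` that is even in the first coordinate. -/
noncomputable def evenPart {n : ℕ} (A : (Fin (n + 1) → Bool) → ℝ) (x : Fin n → Bool) : ℝ :=
  (A (Fin.cons false x) + A (Fin.cons true x)) / 2

/-- The part of `A` that is odd in the first coordinate. -/
noncomputable def oddPart {n : ℕ} (A : (Fin (n + 1) → Bool) → ℝ) (x : Fin n → Bool) : ℝ :=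
  (A (Fin.cons false x) - A (Fin.cons true x)) / 2

theorem sum_cube_succ {n : ℕ} (A : (Fin (n + 1) → Bool) → ℝ) :
    ∑ x, A x = ∑ x : Fin n → Bool, A (Fin.cons false x) + ∑ x, A (Fin.cons true x) := by
  rw [← (Fin.consEquiv fun _ : Fin (n + 1) => Bool).sum_comp, Fintype.sum_prod_type]
  simp [Fin.consEquiv, add_comm]

theorem cubeMean_succ {n : ℕ} (A : (Fin (n + 1) → Bool) → ℝ) :
    cubeMean A =
      (cubeMean (fun x => A (Fin.cons false x)) + cubeMean fun x => A (Fin.cons true x)) / 2 := by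
  simp only [cubeMean, sum_cube_succ, pow_succ]
  ring

theorem cubeMean_add {n : ℕ} (A B : (Fin n → Bool) → ℝ) :
    (cubeMean fun x => A x + B x) = cubeMean A + cubeMean B := by
  simp only [cubeMean, Finset.sum_add_distrib, mul_add]

theorem cubeMean_const_mul {n : ℕ} (c : ℝ) (A : (Fin n → Bool) → ℝ) :
    (cubeMean fun x => c * A x) = c * cubeMean A := by
  simp only [cubeMean, ← Finset.mul_sum]
  ring

theorem cubeMean_mono {n : ℕ} {A B : (Fin n → Bool) → ℝ} (h : ∀ x, A x ≤ B x) :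
    cubeMean A ≤ cubeMean B :=
  mul_le_mul_of_nonneg_left (Finset.sum_le_sum fun x _ => h x) (by positivity)

theorem cubeMean_nonneg {n : ℕ} {A : (Fin n → Bool) → ℝ} (h : ∀ x, 0 ≤ A x) : 0 ≤ cubeMean A :=
  mul_nonneg (by positivity) (Finset.sum_nonneg fun x _ => h x)

theorem cubeMean_evenPart {n : ℕ} (A : (Fin (n + 1) → Bool) → ℝ) :
    cubeMean (evenPart A) = cubeMean A := by
  rw [cubeMean_succ, ← cubeMean_add, div_eq_inv_mul, ← cubeMean_const_mul]
  congr 1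
  ext x
  simp only [evenPart]
  ring

/-- With crossover `(1 - ρ)/2`, one coordinate of noise fixes constants and scales the sign
character by `ρ`; this drives every induction on dimension. -/
theorem noiseOp_cons (ρ : ℝ) {n : ℕ} (A : (Fin (n + 1) → Bool) → ℝ) (b : Bool)
    (x : Fin n → Bool) :
    noiseOp ρ A (Fin.cons b x) =
      noiseOp ρ (evenPart A) x + (if b then -ρ else ρ) * noiseOp ρ (oddPart A) x := by
  simp only [noiseOp, sum_cube_succ, memorylessChannel, Fin.prod_univ_succ, Fin.cons_zero,
    Fin.cons_succ, evenPart, oddPart, bsc, Finset.mul_sum]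
  rw [← Finset.sum_add_distrib, ← Finset.sum_add_distrib]
  refine Finset.sum_congr rfl fun y _ => ?_
  cases b <;> simp <;> ring

theorem cubeMean_noiseOp_sq_succ (ρ : ℝ) {n : ℕ} (A : (Fin (n + 1) → Bool) → ℝ) :
    (cubeMean fun x => noiseOp ρ A x ^ 2) =
      (cubeMean fun x => noiseOp ρ (evenPart A) x ^ 2) +
        ρ ^ 2 * cubeMean fun x => noiseOp ρ (oddPart A) x ^ 2 := by
  rw [cubeMean_succ, ← cubeMean_add, ← cubeMean_const_mul, ← cubeMean_add, div_eq_inv_mul,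
    ← cubeMean_const_mul]
  congr 1
  ext x
  simp only [noiseOp_cons]
  simp
  ring

theorem noiseOp_of_dim_zero (ρ : ℝ) (A : (Fin 0 → Bool) → ℝ) : noiseOp ρ A = A := by
  ext x
  rw [noiseOp, Fintype.sum_unique, memorylessChannel, Fin.prod_univ_zero, one_mul]
  exact congrArg A (Subsingleton.elim _ _)

theorem sq_cubeMean_le (ρ : ℝ) {n : ℕ} (A : (Fin n → Bool) → ℝ) :
    cubeMean A ^ 2 ≤ cubeMean fun x => noiseOp ρ A x ^ 2 := by
  induction n with
  | zero => simp [noiseOp_of_dim_zero, cubeMean]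
  | succ n ih =>
    rw [cubeMean_noiseOp_sq_succ, ← cubeMean_evenPart]
    have h := cubeMean_nonneg (A := fun x => noiseOp ρ (oddPart A) x ^ 2) fun x => sq_nonneg _
    nlinarith [ih (evenPart A), mul_nonneg (sq_nonneg ρ) h]

/-- Additional noise contracts the mean-zero part of a function. -/
theorem cubeMean_noiseOp_mul_sq_le {τ : ℝ} (hτ₀ : 0 ≤ τ) (hτ₁ : τ ≤ 1) (σ : ℝ) {n : ℕ}
    (A : (Fin n → Bool) → ℝ) :
    (cubeMean fun x => noiseOp (τ * σ) A x ^ 2) ≤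
      τ ^ 2 * (cubeMean fun x => noiseOp σ A x ^ 2) + (1 - τ ^ 2) * cubeMean A ^ 2 := by
  induction n with
  | zero =>
    simp [noiseOp_of_dim_zero, cubeMean]
    linarith
  | succ n ih =>
    rw [cubeMean_noiseOp_sq_succ, cubeMean_noiseOp_sq_succ, ← cubeMean_evenPart A]
    have hτ : 0 ≤ 1 - τ ^ 2 := by nlinarith
    have h1 := ih (evenPart A)
    have h2 := ih (oddPart A)
    -- The odd part need not have mean zero, but it already carries a factor `τ²` from the split
    -- coordinate, so plain contraction suffices.
    have h3 := mul_le_mul_of_nonneg_left (sq_cubeMean_le σ (oddPart A)) hτ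
    have h4 := mul_le_mul_of_nonneg_left (h2.trans (add_le_add_right h3 _)) (sq_nonneg (τ * σ))
    linarith

/-! ### Bonami's two-point inequality. -/

theorem two_mul_mul_le_rpow_sub_rpow {r y : ℝ} (hr₀ : 0 ≤ r) (hr₁ : r ≤ 1) (hy₀ : 0 ≤ y)
    (hy₁ : y ≤ 1) : 2 * r * y ≤ (1 + y) ^ r - (1 - y) ^ r := by
  rcases hr₀.eq_or_lt with rfl | hr
  · simp
  have hmono : MonotoneOn (fun t : ℝ => (1 + t) ^ r - (1 - t) ^ r - 2 * r * t)
      (Set.Icc 0 1) := by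
    refine monotoneOn_of_hasDerivWithinAt_nonneg (convex_Icc 0 1)
      (f' := fun t => r * (1 + t) ^ (r - 1) + r * (1 - t) ^ (r - 1) - 2 * r) ?_ ?_ ?_
    · refine ContinuousOn.sub (ContinuousOn.sub ?_ ?_) (by fun_prop)
      · exact ContinuousOn.rpow_const (by fun_prop) fun _ _ => Or.inr hr.le
      · exact ContinuousOn.rpow_const (by fun_prop) fun _ _ => Or.inr hr.le
    · intro t ht
      rw [interior_Icc] at ht
      have h1 : HasDerivAt (fun t : ℝ => (1 + t) ^ r) (1 * r * (1 + t) ^ (r - 1)) t :=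
        ((hasDerivAt_id t).const_add 1).rpow_const (Or.inl (by simp; linarith [ht.1]))
      have h2 : HasDerivAt (fun t : ℝ => (1 - t) ^ r) (-1 * r * (1 - t) ^ (r - 1)) t :=
        ((hasDerivAt_id t).const_sub 1).rpow_const (Or.inl (by simp; linarith [ht.2]))
      have h3 : HasDerivAt (fun t : ℝ => 2 * r * t) (2 * r * 1) t :=
        (hasDerivAt_id t).const_mul _
      refine (((h1.sub h2).sub h3).congr_deriv ?_).hasDerivWithinAt
      ring
    · intro t ht
      rw [interior_Icc] at ht
      have h1 : 0 < 1 - t := by linarith [ht.2]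
      have h2 : 0 < 1 + t := by linarith [ht.1]
      have hu : 0 < (1 + t) ^ (r - 1) := Real.rpow_pos_of_pos h2 _
      have hv : 0 < (1 - t) ^ (r - 1) := Real.rpow_pos_of_pos h1 _
      -- The product is `(1 - t²)^(r-1)` with `r ≤ 1`; AM–GM then makes the derivative nonnegative.
      have huv : 1 ≤ (1 + t) ^ (r - 1) * (1 - t) ^ (r - 1) := by
        rw [← Real.mul_rpow h2.le h1.le]
        exact Real.one_le_rpow_of_pos_of_le_one_of_nonpos (by positivity)
          (by nlinarith [sq_nonneg t]) (by linarith)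
      have : 2 ≤ (1 + t) ^ (r - 1) + (1 - t) ^ (r - 1) := by
        nlinarith [sq_nonneg ((1 + t) ^ (r - 1) - (1 - t) ^ (r - 1))]
      nlinarith
  have := hmono (Set.left_mem_Icc.2 zero_le_one) ⟨hy₀, hy₁⟩ hy₀
  simp at this
  linarith

/-- The derivative of the difference is `p/2` times the gap in `two_mul_mul_le_rpow_sub_rpow` at `r
= p - 1`. -/
theorem one_add_mul_sq_le_rpow_add_rpow {p y : ℝ} (hp₁ : 1 ≤ p) (hp₂ : p ≤ 2) (hy₀ : 0 ≤ y)
    (hy₁ : y ≤ 1) : 1 + p / 2 * ((p - 1) * y ^ 2) ≤ ((1 + y) ^ p + (1 - y) ^ p) / 2 := by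
  have hmono : MonotoneOn
      (fun t : ℝ => ((1 + t) ^ p + (1 - t) ^ p) / 2 - p / 2 * ((p - 1) * t ^ 2))
      (Set.Icc 0 1) := by
    have hd : ∀ t : ℝ, HasDerivAt
        (fun t : ℝ => ((1 + t) ^ p + (1 - t) ^ p) / 2 - p / 2 * ((p - 1) * t ^ 2))
        (p / 2 * ((1 + t) ^ (p - 1) - (1 - t) ^ (p - 1) - 2 * (p - 1) * t)) t := by
      intro t
      have h1 : HasDerivAt (fun t : ℝ => (1 + t) ^ p) (1 * p * (1 + t) ^ (p - 1)) t :=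
        ((hasDerivAt_id t).const_add 1).rpow_const (Or.inr hp₁)
      have h2 : HasDerivAt (fun t : ℝ => (1 - t) ^ p) (-1 * p * (1 - t) ^ (p - 1)) t :=
        ((hasDerivAt_id t).const_sub 1).rpow_const (Or.inr hp₁)
      have h3 : HasDerivAt (fun t : ℝ => p / 2 * ((p - 1) * t ^ 2))
          (p / 2 * ((p - 1) * (2 * t))) t := by
        simpa using ((hasDerivAt_pow 2 t).const_mul (p - 1)).const_mul (p / 2)
      refine (((h1.add h2).div_const 2).sub h3).congr_deriv ?_
      ring
    refine monotoneOn_of_hasDerivWithinAt_nonneg (convex_Icc 0 1)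
      (fun t _ => (hd t).continuousAt.continuousWithinAt)
      (fun t _ => (hd t).hasDerivWithinAt) fun t ht => ?_
    rw [interior_Icc] at ht
    have := two_mul_mul_le_rpow_sub_rpow (r := p - 1) (by linarith) (by linarith) ht.1.le ht.2.le
    exact mul_nonneg (by linarith) (by linarith)
  have := hmono (Set.left_mem_Icc.2 zero_le_one) ⟨hy₀, hy₁⟩ hy₀
  simp at this
  linarith

/-- The two-point inequality when the second entry is dominated by the first. -/
theorem two_point_inequality_of_le {p a b : ℝ} (hp₁ : 1 ≤ p) (hp₂ : p ≤ 2) (hb : 0 ≤ b)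
    (hab : b ≤ a) :
    (a ^ 2 + (p - 1) * b ^ 2) ^ (p / 2) ≤ (|a + b| ^ p + |a - b| ^ p) / 2 := by
  rcases (hb.trans hab).eq_or_lt with rfl | ha
  · obtain rfl : b = 0 := le_antisymm hab hb
    simp [Real.zero_rpow (by linarith : p ≠ 0), Real.zero_rpow (by linarith : p / 2 ≠ 0)]
  obtain ⟨y, rfl⟩ : ∃ y, b = a * y := ⟨b / a, by field_simp⟩
  have hy₀ : 0 ≤ y := nonneg_of_mul_nonneg_right hb ha
  have hy₁ : y ≤ 1 := by nlinarith
  have hz : 0 ≤ (p - 1) * y ^ 2 := mul_nonneg (by linarith) (sq_nonneg y)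
  have e1 : a ^ 2 + (p - 1) * (a * y) ^ 2 = a ^ 2 * (1 + (p - 1) * y ^ 2) := by ring
  have e2 : |a + a * y| = a * (1 + y) := by
    rw [abs_of_nonneg (by positivity)]; ring
  have e3 : |a - a * y| = a * (1 - y) := by
    rw [abs_of_nonneg (by linarith)]; ring
  have e4 : (a ^ 2) ^ (p / 2) = a ^ p := by
    rw [← Real.rpow_natCast, ← Real.rpow_mul ha.le]
    congr 1
    push_cast
    ring
  rw [e1, e2, e3, Real.mul_rpow (by positivity) (by linarith), e4, Real.mul_rpow ha.le (by linarith),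
    Real.mul_rpow ha.le (by linarith), ← mul_add, mul_div_assoc]
  refine mul_le_mul_of_nonneg_left ?_ (by positivity)
  -- After scaling to `a = 1`, Bernoulli with exponent `p/2 ≤ 1` linearises the left side.
  refine le_trans ?_ (one_add_mul_sq_le_rpow_add_rpow hp₁ hp₂ hy₀ hy₁)
  exact rpow_one_add_le_one_add_mul_self (by linarith) (by linarith) (by linarith)

/-- Bonami's two-point inequality. -/
theorem two_point_inequality {p : ℝ} (hp₁ : 1 ≤ p) (hp₂ : p ≤ 2) (a b : ℝ) :
    (a ^ 2 + (p - 1) * b ^ 2) ^ (p / 2) ≤ (|a + b| ^ p + |a - b| ^ p) / 2 := by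
  have habs : ∀ a b : ℝ, |(|a| + |b|)| ^ p + |(|a| - |b|)| ^ p = |a + b| ^ p + |a - b| ^ p := by
    intro a b
    rcases abs_cases a with ⟨ha, -⟩ | ⟨ha, -⟩ <;> rcases abs_cases b with ⟨hb, -⟩ | ⟨hb, -⟩ <;>
      rw [ha, hb]
    · rw [← sub_eq_add_neg, sub_neg_eq_add, add_comm]
    · rw [neg_add_eq_sub, abs_sub_comm b a, ← neg_add', abs_neg, add_comm]
    · rw [← neg_add, abs_neg, sub_neg_eq_add, neg_add_eq_sub, abs_sub_comm b a]
  rw [← habs, ← sq_abs a, ← sq_abs b]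
  rcases le_total |b| |a| with h | h
  · exact two_point_inequality_of_le hp₁ hp₂ (abs_nonneg b) h
  -- Exchanging the entries fixes the right side and, as `p ≤ 2`, can only enlarge the left.
  · rw [add_comm |a|, abs_sub_comm |a|]
    refine le_trans ?_ (two_point_inequality_of_le hp₁ hp₂ (abs_nonneg a) h)
    refine Real.rpow_le_rpow ?_ ?_ (by linarith)
    · nlinarith [sq_nonneg |a|, mul_nonneg (sub_nonneg.2 hp₁) (sq_nonneg |b|)]
    · nlinarith [mul_nonneg (sub_nonneg.2 hp₂)
        (sub_nonneg.2 (pow_le_pow_left₀ (abs_nonneg a) h 2))]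

/-! ### Hypercontractivity by induction on dimension. -/

theorem minkowski_sum_pair {ι : Type*} (S : Finset ι) {q : ℝ} (hq : 1 ≤ q) {a b : ι → ℝ}
    (ha : ∀ i, 0 ≤ a i) (hb : ∀ i, 0 ≤ b i) :
    ((∑ i ∈ S, a i) ^ q + (∑ i ∈ S, b i) ^ q) ^ (1 / q) ≤
      ∑ i ∈ S, (a i ^ q + b i ^ q) ^ (1 / q) := by
  classical
  induction S using Finset.induction_on with
  | empty => simp [Real.zero_rpow (by linarith : q ≠ 0), Real.zero_rpow (by positivity : q⁻¹ ≠ 0)]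
  | insert i S hi ih =>
    rw [Finset.sum_insert hi, Finset.sum_insert hi, Finset.sum_insert hi]
    have h := Real.Lp_add_le_of_nonneg (Finset.univ : Finset Bool) (p := q)
      (f := fun c => bif c then a i else b i)
      (g := fun c => bif c then ∑ i ∈ S, a i else ∑ i ∈ S, b i) hq
      (by rintro (_ | _) - <;> simp [ha, hb])
      (by rintro (_ | _) - <;> simp [Finset.sum_nonneg, ha, hb])
    simp only [Fintype.sum_bool, cond_true, cond_false] at h
    linarith

/-- Minkowski with exponent `2/p ≥ 1` exchanges the `L^p` norm over the cube with the `ℓ²` norm of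
the pair, the step that lets the two-point inequality tensorise. -/
theorem minkowski_cubeMean {n : ℕ} {p : ℝ} (hp₀ : 0 < p) (hp₂ : p ≤ 2)
    (F D : (Fin n → Bool) → ℝ) :
    ((cubeMean fun x => |F x| ^ p) ^ (2 / p) + (cubeMean fun x => |D x| ^ p) ^ (2 / p)) ^ (p / 2) ≤
      cubeMean fun x => (F x ^ 2 + D x ^ 2) ^ (p / 2) := by
  have hq : 1 ≤ 2 / p := by rwa [le_div_iff₀ hp₀, one_mul]
  have h := minkowski_sum_pair Finset.univ hq (a := fun x => |F x| ^ p) (b := fun x => |D x| ^ p)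
    (fun x => by positivity) (fun x => by positivity)
  have e : ∀ t : ℝ, (|t| ^ p) ^ (2 / p) = t ^ 2 := by
    intro t
    rw [← Real.rpow_mul (abs_nonneg t), mul_div_cancel₀ _ hp₀.ne', Real.rpow_two, sq_abs]
  simp only [e, one_div_div] at h
  have hc : (0 : ℝ) ≤ (1 / 2) ^ n := by positivity
  have hF : 0 ≤ ∑ x, |F x| ^ p := Finset.sum_nonneg fun x _ => by positivity
  have hD : 0 ≤ ∑ x, |D x| ^ p := Finset.sum_nonneg fun x _ => by positivity
  unfold cubeMean
  rw [Real.mul_rpow hc hF, Real.mul_rpow hc hD, ← mul_add,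
    Real.mul_rpow (by positivity) (by positivity), ← Real.rpow_mul hc,
    show 2 / p * (p / 2) = 1 by field_simp, Real.rpow_one]
  exact mul_le_mul_of_nonneg_left h hc

/-- The Bonami hypercontractive inequality from `L^{1+σ²}` to `L²`. -/
theorem cubeMean_noiseOp_sq_le (σ : ℝ) (hσ : σ ^ 2 ≤ 1) {n : ℕ} (A : (Fin n → Bool) → ℝ) :
    (cubeMean fun x => noiseOp σ A x ^ 2) ≤
      (cubeMean fun x => |A x| ^ (1 + σ ^ 2)) ^ (2 / (1 + σ ^ 2)) := by
  obtain ⟨p, hp⟩ : ∃ p, p = 1 + σ ^ 2 := ⟨_, rfl⟩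
  rw [← hp]
  have hp₁ : 1 ≤ p := by linarith [sq_nonneg σ]
  have hp₂ : p ≤ 2 := by linarith
  have hp₀ : 0 < p := by linarith
  induction n with
  | zero =>
    simp only [noiseOp_of_dim_zero, cubeMean, pow_zero, one_mul, Fintype.sum_unique]
    rw [← Real.rpow_mul (abs_nonneg _), mul_div_cancel₀ _ hp₀.ne', Real.rpow_two, sq_abs]
  | succ n ih =>
    rw [cubeMean_noiseOp_sq_succ]
    have hm := minkowski_cubeMean hp₀ hp₂ (evenPart A) fun x => σ * oddPart A x
    have hσD : (cubeMean fun x => |σ * oddPart A x| ^ p) ^ (2 / p) =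
        σ ^ 2 * (cubeMean fun x => |oddPart A x| ^ p) ^ (2 / p) := by
      simp only [abs_mul, Real.mul_rpow (abs_nonneg _) (abs_nonneg _)]
      rw [cubeMean_const_mul, Real.mul_rpow (by positivity)
        (cubeMean_nonneg fun x => by positivity), ← Real.rpow_mul (abs_nonneg _),
        mul_div_cancel₀ _ hp₀.ne', Real.rpow_two, sq_abs]
    rw [hσD] at hm
    have hA : (cubeMean fun x => (evenPart A x ^ 2 + (σ * oddPart A x) ^ 2) ^ (p / 2)) ≤
        cubeMean fun x => |A x| ^ p := by
      rw [cubeMean_succ, ← cubeMean_add, div_eq_inv_mul (cubeMean _), ← cubeMean_const_mul]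
      refine cubeMean_mono fun x => ?_
      have h := two_point_inequality hp₁ hp₂ (evenPart A x) (oddPart A x)
      have e1 : evenPart A x + oddPart A x = A (Fin.cons false x) := by
        simp only [evenPart, oddPart]; ring
      have e2 : evenPart A x - oddPart A x = A (Fin.cons true x) := by
        simp only [evenPart, oddPart]; ring
      rw [e1, e2] at h
      rw [mul_pow, show σ ^ 2 = p - 1 by linarith]
      linarith
    have hF : 0 ≤ cubeMean fun x => |evenPart A x| ^ p := cubeMean_nonneg fun x => by positivity
    have hD : 0 ≤ cubeMean fun x => |oddPart A x| ^ p := cubeMean_nonneg fun x => by positivity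
    have hS := Real.rpow_le_rpow (by positivity) (hm.trans hA) (z := 2 / p) (by positivity)
    rw [← Real.rpow_mul (by positivity), show p / 2 * (2 / p) = 1 by field_simp,
      Real.rpow_one] at hS
    refine le_trans ?_ hS
    exact add_le_add (ih _) (mul_le_mul_of_nonneg_left (ih _) (sq_nonneg σ))

/-! ### Correlation with a noisy Boolean function. -/

theorem memorylessChannel_bsc_comm (δ : ℝ) {n : ℕ} (x y : Fin n → Bool) :
    memorylessChannel (bsc δ) x y = memorylessChannel (bsc δ) y x := by
  simp only [memorylessChannel, bsc, eq_comm]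

theorem memorylessChannel_bsc_sum (δ : ℝ) {n : ℕ} (x : Fin n → Bool) :
    ∑ y, memorylessChannel (bsc δ) x y = 1 := by
  simp only [memorylessChannel]
  rw [← Fintype.prod_sum fun i b => bsc δ (x i) b]
  refine Finset.prod_eq_one fun i _ => ?_
  cases x i <;> simp [bsc]

/-- A mean-zero function correlates with the noisy version of a sign function by at most its
contracted `L^p` norm. -/
theorem cubeMean_mul_noiseOp_le {τ σ : ℝ} (hτ₀ : 0 ≤ τ) (hτ₁ : τ ≤ 1) (hσ : σ ^ 2 ≤ 1) {n : ℕ}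
    {A φ : (Fin n → Bool) → ℝ} (hA : cubeMean A = 0) (hφ : ∀ x, φ x ^ 2 = 1) :
    (cubeMean fun x => A x * noiseOp (τ * σ) φ x) ≤
      τ * (cubeMean fun x => |A x| ^ (1 + σ ^ 2)) ^ (1 / (1 + σ ^ 2)) := by
  -- The channel kernel is symmetric, so the noise operator is self-adjoint.
  have hsymm : (cubeMean fun x => A x * noiseOp (τ * σ) φ x) =
      cubeMean fun x => φ x * noiseOp (τ * σ) A x := by
    unfold cubeMean noiseOp
    congr 1
    simp only [Finset.mul_sum]
    rw [Finset.sum_comm]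
    refine Finset.sum_congr rfl fun x _ => Finset.sum_congr rfl fun y _ => ?_
    rw [memorylessChannel_bsc_comm]
    ring
  have hp : 0 < 1 + σ ^ 2 := by positivity
  have hm : 0 ≤ cubeMean fun x => |A x| ^ (1 + σ ^ 2) := cubeMean_nonneg fun x => by positivity
  rw [hsymm]
  refine le_of_sq_le_sq ?_ (by positivity)
  have hcs : (cubeMean fun x => φ x * noiseOp (τ * σ) A x) ^ 2 ≤
      cubeMean fun x => noiseOp (τ * σ) A x ^ 2 := by
    have h := Finset.sum_mul_sq_le_sq_mul_sq Finset.univ φ (noiseOp (τ * σ) A)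
    simp only [hφ, Finset.sum_const, Finset.card_univ, Fintype.card_pi, Fintype.card_bool,
      Finset.prod_const, Fintype.card_fin, nsmul_eq_mul, mul_one] at h
    unfold cubeMean
    rw [mul_pow]
    refine (mul_le_mul_of_nonneg_left h (by positivity)).trans_eq ?_
    push_cast
    rw [← mul_assoc, sq, mul_assoc ((1 / 2 : ℝ) ^ n), ← mul_pow]
    norm_num
  have h1 := cubeMean_noiseOp_mul_sq_le hτ₀ hτ₁ σ A
  rw [hA] at h1
  have h2 := mul_le_mul_of_nonneg_left (cubeMean_noiseOp_sq_le σ hσ A) (sq_nonneg τ)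
  rw [mul_pow, ← Real.rpow_natCast (_ ^ _), ← Real.rpow_mul hm]
  have e : 1 / (1 + σ ^ 2) * ((2 : ℕ) : ℝ) = 2 / (1 + σ ^ 2) := by push_cast; ring
  rw [e]
  linarith

/-! ### Guessing moments under uniform input. -/

/-- The normalized power sum `m⁻¹ ∑_{k=1}^m k^r`. -/
noncomputable def powerMean (m : ℕ) (r : ℝ) : ℝ :=
  (m : ℝ)⁻¹ * ∑ k ∈ Finset.range m, ((k + 1 : ℕ) : ℝ) ^ r

theorem sum_guessOrd {α : Type*} [Fintype α] (p : α → ℝ) (g : ℕ → ℝ) :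
    ∑ x, g (guessOrd p x) = ∑ k ∈ Finset.range (Fintype.card α), g (k + 1) := by
  rw [Finset.sum_range]
  exact ((Fintype.equivFin α).trans
    (Tuple.sort fun i => -p ((Fintype.equivFin α).symm i)).symm).sum_comp
      fun k : Fin (Fintype.card α) => g (k + 1)

theorem cubeMean_guessOrd_rpow {n : ℕ} (p : (Fin n → Bool) → ℝ) (r : ℝ) :
    (cubeMean fun x => (guessOrd p x : ℝ) ^ r) = powerMean (2 ^ n) r := by
  have h := sum_guessOrd p fun k => (k : ℝ) ^ r
  simp only [Fintype.card_pi, Fintype.card_bool, Finset.prod_const, Finset.card_univ,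
    Fintype.card_fin] at h
  rw [cubeMean, h, powerMean]
  simp

theorem iidLaw_uniformBit {n : ℕ} (x : Fin n → Bool) : iidLaw uniformBit x = (1 / 2) ^ n := by
  simp [iidLaw, uniformBit]

theorem guessingMoment_uniform (s : ℝ) (n : ℕ) :
    guessingMoment s (iidLaw uniformBit (n := n)) = powerMean (2 ^ n) s := by
  rw [← cubeMean_guessOrd_rpow (iidLaw uniformBit)]
  simp only [guessingMoment, cubeMean, Finset.mul_sum]
  exact Finset.sum_congr rfl fun x _ => by rw [iidLaw_uniformBit]

/-- The joint law of the input and a Boolean function of the output, in terms of the noise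
operator applied to the corresponding sign function. -/
theorem jointLaw_uniform_bsc (δ : ℝ) {n : ℕ} (f : (Fin n → Bool) → Bool) (x : Fin n → Bool)
    (b : Bool) :
    jointLaw uniformBit (bsc δ) f x b = (1 / 2) ^ n *
      ((1 + (if b then 1 else -1) *
        noiseOp (1 - 2 * δ) (fun y => if f y then 1 else -1) x) / 2) := by
  have hδ : (1 - (1 - 2 * δ)) / 2 = δ := by ring
  simp only [jointLaw, iidLaw_uniformBit, noiseOp, hδ]
  rw [← Finset.mul_sum]
  congr 1
  conv_rhs => rw [Finset.mul_sum]
  -- Writing `1` as a row sum reduces the claim termwise to `1_{f y = b} = (1 ± φ y)/2`.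
  nth_rewrite 1 [← memorylessChannel_bsc_sum δ x]
  rw [← Finset.sum_add_distrib, Finset.sum_div, Finset.sum_filter]
  refine Finset.sum_congr rfl fun y _ => ?_
  cases b <;> cases f y <;> simp

theorem cubeMean_abs_sub_rpow_le {n : ℕ} {p : ℝ} (hp : 1 ≤ p) (a b : (Fin n → Bool) → ℝ) :
    (cubeMean fun x => |a x - b x| ^ p) ^ (1 / p) ≤
      (cubeMean fun x => |a x| ^ p) ^ (1 / p) + (cubeMean fun x => |b x| ^ p) ^ (1 / p) := by
  have h := Real.Lp_add_le Finset.univ a (fun x => -b x) hp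
  simp only [abs_neg, ← sub_eq_add_neg] at h
  unfold cubeMean
  rw [Real.mul_rpow (by positivity) (Finset.sum_nonneg fun x _ => by positivity),
    Real.mul_rpow (by positivity) (Finset.sum_nonneg fun x _ => by positivity),
    Real.mul_rpow (by positivity) (Finset.sum_nonneg fun x _ => by positivity), ← mul_add]
  exact mul_le_mul_of_nonneg_left h (by positivity)

/-- The two terms of the triangle inequality have equal norm, and their factor 2 cancels the 1/2 in
front of the correlation. Only bijectivity of the orders enters, never optimality, so a bit value of
probability zero needs no separate case. -/
theorem le_condGuessingMoment (s : ℝ) {δ τ σ : ℝ} (hτ₀ : 0 ≤ τ) (hτ₁ : τ ≤ 1) (hσ : σ ^ 2 ≤ 1)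
    (hδ : 1 - 2 * δ = τ * σ) {n : ℕ} (f : (Fin n → Bool) → Bool) :
    powerMean (2 ^ n) s -
        τ * powerMean (2 ^ n) (s * (1 + σ ^ 2)) ^ (1 / (1 + σ ^ 2)) ≤
      condGuessingMoment s (jointLaw uniformBit (bsc δ) f) := by
  obtain ⟨p, hp⟩ : ∃ p, p = 1 + σ ^ 2 := ⟨_, rfl⟩
  have hp₁ : 1 ≤ p := by linarith [sq_nonneg σ]
  unfold condGuessingMoment
  rw [Fintype.sum_bool]
  set P : Bool → (Fin n → Bool) → ℝ := fun b x' => jointLaw uniformBit (bsc δ) f x' b /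
    ∑ x'', jointLaw uniformBit (bsc δ) f x'' b with hP
  set a : Bool → (Fin n → Bool) → ℝ := fun b x => (guessOrd (P b) x : ℝ) ^ s with ha
  have hmean : ∀ b, cubeMean (a b) = powerMean (2 ^ n) s := fun b => cubeMean_guessOrd_rpow _ _
  have hpow : ∀ b, (cubeMean fun x => |a b x| ^ p) = powerMean (2 ^ n) (s * p) := by
    intro b
    rw [← cubeMean_guessOrd_rpow (P b)]
    congr 1
    ext x
    rw [ha, abs_of_nonneg (by positivity), ← Real.rpow_mul (by positivity)]
  set φ : (Fin n → Bool) → ℝ := fun y => if f y then 1 else -1 with hφ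
  have hdiff : (cubeMean fun x => a false x - a true x) = 0 := by
    have h := cubeMean_add (a false) fun x => -1 * a true x
    rw [cubeMean_const_mul, hmean, hmean] at h
    simpa [← sub_eq_add_neg] using h
  have hcorr := cubeMean_mul_noiseOp_le hτ₀ hτ₁ hσ hdiff (φ := φ) fun x => by
    simp only [hφ]; split_ifs <;> norm_num
  have htri := cubeMean_abs_sub_rpow_le hp₁ (a false) (a true)
  rw [hpow, hpow] at htri
  rw [← hp, ← hδ] at hcorr
  rw [← hp]
  have hsum : ∀ b, ∑ x, jointLaw uniformBit (bsc δ) f x b * (guessOrd (P b) x : ℝ) ^ s =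
      cubeMean fun x => (1 / 2) * a b x +
        (if b then 1 / 2 else -1 / 2) * (a b x * noiseOp (1 - 2 * δ) φ x) := by
    intro b
    rw [cubeMean, Finset.mul_sum]
    refine Finset.sum_congr rfl fun x _ => ?_
    rw [jointLaw_uniform_bsc]
    cases b <;> simp only [ha, hφ] <;> simp <;> ring
  have hsplit : (cubeMean fun x => (a false x - a true x) * noiseOp (1 - 2 * δ) φ x) =
      (cubeMean fun x => a false x * noiseOp (1 - 2 * δ) φ x) +
        -1 * cubeMean fun x => a true x * noiseOp (1 - 2 * δ) φ x := by
    rw [← cubeMean_const_mul, ← cubeMean_add]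
    congr 1
    ext x
    ring
  rw [hsum, hsum, cubeMean_add, cubeMean_add, cubeMean_const_mul, cubeMean_const_mul,
    cubeMean_const_mul, cubeMean_const_mul, hmean, hmean]
  have := mul_le_mul_of_nonneg_left htri hτ₀
  simp only [if_true, Bool.false_eq_true, if_false]
  linarith

/-! ### Asymptotics of power sums. -/

/-- Bernoulli gives `k^(r+1) - (k-1)^(r+1) ≤ (r+1) k^r`, which telescopes. -/
theorem rpow_div_le_powerMean {r : ℝ} (hr : 0 ≤ r) {m : ℕ} (hm : 0 < m) :
    (m : ℝ) ^ r / (r + 1) ≤ powerMean m r := by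
  have h : ∀ m : ℕ, (m : ℝ) ^ (r + 1) / (r + 1) ≤
      ∑ k ∈ Finset.range m, ((k + 1 : ℕ) : ℝ) ^ r := by
    intro m
    induction m with
    | zero => simp [Real.zero_rpow (by linarith : r + 1 ≠ 0)]
    | succ m ih =>
      rw [Finset.sum_range_succ]
      have hx : (0 : ℝ) < ((m + 1 : ℕ) : ℝ) := by positivity
      have hx₁ : (1 : ℝ) ≤ ((m + 1 : ℕ) : ℝ) := by push_cast; linarith [m.cast_nonneg (α := ℝ)]
      have hb := one_add_mul_self_le_rpow_one_add (s := -(((m + 1 : ℕ) : ℝ)⁻¹)) (p := r + 1)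
        (by linarith [inv_le_one_of_one_le₀ hx₁]) (by linarith)
      have e : (m : ℝ) = ((m + 1 : ℕ) : ℝ) * (1 + -(((m + 1 : ℕ) : ℝ)⁻¹)) := by
        field_simp; push_cast; ring
      have hm : (m : ℝ) ^ (r + 1) =
          ((m + 1 : ℕ) : ℝ) ^ (r + 1) * (1 + -(((m + 1 : ℕ) : ℝ)⁻¹)) ^ (r + 1) := by
        rw [← Real.mul_rpow hx.le (by linarith [inv_le_one_of_one_le₀ hx₁]), ← e]
      have h2 := mul_le_mul_of_nonneg_left hb (by positivity : 0 ≤ ((m + 1 : ℕ) : ℝ) ^ (r + 1))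
      rw [← hm] at h2
      have h3 : ((m + 1 : ℕ) : ℝ) ^ (r + 1) * (1 + (r + 1) * -(((m + 1 : ℕ) : ℝ)⁻¹)) =
          ((m + 1 : ℕ) : ℝ) ^ (r + 1) - (r + 1) * ((m + 1 : ℕ) : ℝ) ^ r := by
        rw [Real.rpow_add_one hx.ne']
        field_simp
        ring
      rw [h3] at h2
      have hr1 : 0 < r + 1 := by linarith
      rw [div_le_iff₀ hr1] at ih ⊢
      linarith
  have hm' : (0 : ℝ) < m := by exact_mod_cast hm
  unfold powerMean
  rw [le_inv_mul_iff₀ hm']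
  refine le_trans (le_of_eq ?_) (h m)
  rw [Real.rpow_add_one hm'.ne']
  ring

/-- Bernoulli in the other direction, `(k+1)^(r+1) - k^(r+1) ≥ (r+1) k^r`; the shift to `m + 1`
costs a factor tending to 1. -/
theorem powerMean_le {r : ℝ} (hr : 0 ≤ r) {m : ℕ} (hm : 0 < m) :
    powerMean m r ≤ (m : ℝ) ^ r * ((1 + (m : ℝ)⁻¹) ^ (r + 1) / (r + 1)) := by
  have h : ∀ m : ℕ, ∑ k ∈ Finset.range m, ((k + 1 : ℕ) : ℝ) ^ r ≤
      ((m + 1 : ℕ) : ℝ) ^ (r + 1) / (r + 1) := by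
    intro m
    induction m with
    | zero => simp; positivity
    | succ m ih =>
      rw [Finset.sum_range_succ]
      have hx : (0 : ℝ) < ((m + 1 : ℕ) : ℝ) := by positivity
      have hb := one_add_mul_self_le_rpow_one_add (s := ((m + 1 : ℕ) : ℝ)⁻¹) (p := r + 1)
        (by linarith [inv_pos.2 hx]) (by linarith)
      have e : ((m + 1 + 1 : ℕ) : ℝ) = ((m + 1 : ℕ) : ℝ) * (1 + ((m + 1 : ℕ) : ℝ)⁻¹) := by
        field_simp; push_cast; ring
      have h2 := mul_le_mul_of_nonneg_left hb (by positivity : 0 ≤ ((m + 1 : ℕ) : ℝ) ^ (r + 1))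
      rw [← Real.mul_rpow hx.le (by positivity), ← e] at h2
      have h3 : ((m + 1 : ℕ) : ℝ) ^ (r + 1) * (1 + (r + 1) * ((m + 1 : ℕ) : ℝ)⁻¹) =
          ((m + 1 : ℕ) : ℝ) ^ (r + 1) + (r + 1) * ((m + 1 : ℕ) : ℝ) ^ r := by
        rw [Real.rpow_add_one hx.ne']
        field_simp
      rw [h3] at h2
      have hr1 : 0 < r + 1 := by linarith
      rw [le_div_iff₀ hr1] at ih ⊢
      linarith
  have hm' : (0 : ℝ) < m := by exact_mod_cast hm
  unfold powerMean
  rw [inv_mul_le_iff₀ hm']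
  refine (h m).trans (le_of_eq ?_)
  have e : ((m + 1 : ℕ) : ℝ) = m * (1 + (m : ℝ)⁻¹) := by field_simp; push_cast; ring
  rw [e, Real.mul_rpow hm'.le (by positivity), Real.rpow_add_one hm'.ne']
  ring

/-- The quotient of two power means of matching homogeneity. -/
theorem powerMean_rpow_div_le {s p : ℝ} (hs : 0 < s) (hp : 0 < p) {m : ℕ} (hm : 0 < m) :
    powerMean m (s * p) ^ (1 / p) / powerMean m s ≤
      (s + 1) * ((1 + (m : ℝ)⁻¹) ^ (s * p + 1) / (s * p + 1)) ^ (1 / p) := by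
  have hm' : (0 : ℝ) < m := by exact_mod_cast hm
  have hsp : 0 ≤ s * p := by positivity
  have h1 := rpow_div_le_powerMean hs.le hm
  have h2 := powerMean_le hsp hm
  have h0 : 0 < (m : ℝ) ^ s / (s + 1) := by positivity
  rw [div_le_iff₀ (h0.trans_le h1)]
  have hnn : 0 ≤ powerMean m (s * p) :=
    (by positivity : 0 ≤ (m : ℝ) ^ (s * p) / (s * p + 1)).trans (rpow_div_le_powerMean hsp hm)
  refine (Real.rpow_le_rpow hnn h2 (by positivity)).trans ?_
  rw [Real.mul_rpow (by positivity) (by positivity), ← Real.rpow_mul hm'.le,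
    show s * p * (1 / p) = s by field_simp]
  refine le_trans (le_of_eq ?_) (mul_le_mul_of_nonneg_left h1 (by positivity))
  field_simp

/-! ### The limit in `n` and the maximum over `λ`. -/

theorem le_guessingEfficiencyAt {s δ τ σ : ℝ} (hs : 0 < s) (hτ₀ : 0 ≤ τ) (hτ₁ : τ ≤ 1)
    (hσ : σ ^ 2 ≤ 1) (hδ : 1 - 2 * δ = τ * σ) (n : ℕ) :
    1 - τ * ((s + 1) * ((1 + (((2 ^ n : ℕ) : ℝ))⁻¹) ^ (s * (1 + σ ^ 2) + 1) /
        (s * (1 + σ ^ 2) + 1)) ^ (1 / (1 + σ ^ 2))) ≤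
      guessingEfficiencyAt s uniformBit (bsc δ) n := by
  refine Finset.le_inf' _ _ fun f _ => ?_
  have hN : 0 < 2 ^ n := by positivity
  have hpos : 0 < powerMean (2 ^ n) s :=
    (by positivity : (0 : ℝ) < ((2 ^ n : ℕ) : ℝ) ^ s / (s + 1)).trans_le
      (rpow_div_le_powerMean hs.le hN)
  have h1 := le_condGuessingMoment s hτ₀ hτ₁ hσ hδ f
  have h2 := mul_le_mul_of_nonneg_left
    (powerMean_rpow_div_le hs (by positivity : 0 < 1 + σ ^ 2) hN) hτ₀
  rw [guessingMoment_uniform]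
  have h3 := (div_le_div_iff_of_pos_right hpos).2 h1
  rw [sub_div, div_self hpos.ne', mul_div_assoc] at h3
  linarith

theorem le_guessingEfficiency {s δ τ σ : ℝ} (hs : 0 < s) (hτ₀ : 0 ≤ τ) (hτ₁ : τ ≤ 1)
    (hσ : σ ^ 2 ≤ 1) (hδ : 1 - 2 * δ = τ * σ) :
    ((1 - (s + 1) * τ / ((1 + σ ^ 2) * s + 1) ^ (1 / (1 + σ ^ 2)) : ℝ) : EReal) ≤
      guessingEfficiency s uniformBit (bsc δ) := by
  have hinv : Tendsto (fun n : ℕ => (((2 ^ n : ℕ) : ℝ))⁻¹) atTop (nhds 0) :=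
    tendsto_inv_atTop_zero.comp
      (tendsto_natCast_atTop_atTop.comp (tendsto_pow_atTop_atTop_of_one_lt one_lt_two))
  have hpos : 0 < s * (1 + σ ^ 2) + 1 := by positivity
  have hlim : Tendsto (fun n : ℕ => 1 - τ * ((s + 1) * ((1 + (((2 ^ n : ℕ) : ℝ))⁻¹) ^
      (s * (1 + σ ^ 2) + 1) / (s * (1 + σ ^ 2) + 1)) ^ (1 / (1 + σ ^ 2)))) atTop
      (nhds (1 - τ * ((s + 1) * ((1 + 0) ^ (s * (1 + σ ^ 2) + 1) /
        (s * (1 + σ ^ 2) + 1)) ^ (1 / (1 + σ ^ 2))))) := by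
    refine tendsto_const_nhds.sub (Tendsto.const_mul _ (Tendsto.const_mul _ ?_))
    refine Tendsto.rpow_const (Tendsto.div_const ?_ _) (Or.inr (by positivity))
    exact Tendsto.rpow_const (tendsto_const_nhds.add hinv) (Or.inr hpos.le)
  have e : 1 - (s + 1) * τ / ((1 + σ ^ 2) * s + 1) ^ (1 / (1 + σ ^ 2)) =
      1 - τ * ((s + 1) * ((1 + 0) ^ (s * (1 + σ ^ 2) + 1) /
        (s * (1 + σ ^ 2) + 1)) ^ (1 / (1 + σ ^ 2))) := by
    rw [add_zero, Real.one_rpow, Real.div_rpow zero_le_one hpos.le, Real.one_rpow,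
      mul_comm (1 + σ ^ 2) s]
    ring
  rw [e]
  have hE := (continuous_coe_real_ereal.tendsto _).comp hlim
  rw [← hE.limsup_eq]
  refine limsup_le_limsup (Eventually.of_forall fun n => ?_)
  exact EReal.coe_le_coe_iff.2 (le_guessingEfficiencyAt hs hτ₀ hτ₁ hσ hδ n)

theorem exists_isGreatest_bound {s ρ : ℝ} (hs : 0 < s) (hρ : 0 ≤ ρ) :
    ∃ M : ℝ, IsGreatest
      ((fun l : ℝ => 1 - (s + 1) * ρ ^ l /
        ((1 + ρ ^ (2 * (1 - l))) * s + 1) ^ (1 / (1 + ρ ^ (2 * (1 - l))))) ''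
          Set.Icc (0 : ℝ) 1) M := by
  rcases hρ.eq_or_lt with rfl | hρ
  -- At `ρ = 0` continuity fails at `l = 0`, where `0 ^ 0 = 1`; the trivial upper bound 1 is
  -- attained at `l = 1`.
  · refine ⟨1, ⟨1, by simp, by simp⟩, ?_⟩
    rintro _ ⟨l, -, rfl⟩
    exact sub_le_self _ (by positivity)
  · refine (isCompact_Icc.image ?_).exists_isGreatest ((Set.nonempty_Icc.2 zero_le_one).image _)
    have h1 : Continuous fun l : ℝ => ρ ^ (2 * (1 - l)) :=
      Continuous.rpow (by fun_prop) (by fun_prop) fun _ => Or.inl hρ.ne'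
    have h2 : Continuous fun l : ℝ => ρ ^ l :=
      Continuous.rpow (by fun_prop) (by fun_prop) fun _ => Or.inl hρ.ne'
    have hp : ∀ l : ℝ, 1 + ρ ^ (2 * (1 - l)) ≠ 0 := fun l => by positivity
    have hb : ∀ l : ℝ, (1 + ρ ^ (2 * (1 - l))) * s + 1 ≠ 0 := fun l => by positivity
    refine continuous_const.sub ((continuous_const.mul h2).div
      (Continuous.rpow (by fun_prop) (continuous_const.div (by fun_prop) hp)
        fun l => Or.inl (hb l)) fun l => ?_)
    positivity

theorem mainTheorem4 (s : ℝ) (hs : 0 < s) (δ : ℝ) (hδ₀ : 0 ≤ δ) (hδ₁ : δ ≤ 1 / 2) :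
    ∃ M : ℝ,
      IsGreatest
        ((fun l : ℝ =>
            1 - (s + 1) * (1 - 2 * δ) ^ l /
              ((1 + (1 - 2 * δ) ^ (2 * (1 - l))) * s + 1) ^
                (1 / (1 + (1 - 2 * δ) ^ (2 * (1 - l))))) '' Set.Icc (0 : ℝ) 1) M ∧
      (M : EReal) ≤ guessingEfficiency s uniformBit (bsc δ) := by
  have hρ₀ : 0 ≤ 1 - 2 * δ := by linarith
  have hρ₁ : 1 - 2 * δ ≤ 1 := by linarith
  obtain ⟨M, hM⟩ := exists_isGreatest_bound hs hρ₀
  refine ⟨M, hM, ?_⟩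
  obtain ⟨l, ⟨hl₀, hl₁⟩, rfl⟩ := hM.1
  have hl : 0 ≤ 1 - l := by linarith
  have hσ : (1 - 2 * δ) ^ (2 * (1 - l)) = ((1 - 2 * δ) ^ (1 - l)) ^ 2 := by
    rw [← Real.rpow_natCast, ← Real.rpow_mul hρ₀, mul_comm 2 (1 - l), Nat.cast_ofNat]
  simp only [hσ]
  -- Here `τ = ρ^l` and `σ = ρ^(1-l)` for the maximising `l`.
  refine le_guessingEfficiency hs (Real.rpow_nonneg hρ₀ _) (Real.rpow_le_one hρ₀ hρ₁ hl₀)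
    (pow_le_one₀ (Real.rpow_nonneg hρ₀ _) (Real.rpow_le_one hρ₀ hρ₁ hl)) ?_
  rw [← Real.rpow_add_of_nonneg hρ₀ hl₀ hl, add_sub_cancel, Real.rpow_one]
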